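/- Let $a_i\in\mathbb R^n$ for $i\in I_1\cup I_2$ ($I_1,I_2$ finite disjoint index sets), $b_i\in\mathbb R$ for $i\in I_1$ and $b_i:=0$ for $i\in I_2$, and let $\Theta=\{x\in\mathbb R^n:\langle a_i,x\rangle\le b_i\ \forall i\in I_1\}$, $\mathcal C=\{x\in\mathbb R^n:\langle a_i,x\rangle\le 0\ \forall i\in I_2\}$. Let $c\in\mathbb R^n$ and $f:\mathbb R^n\to\mathbb R\cup\{\infty\}$ (a function given only on $\Theta$ may be extended by $\infty$). Consider the simple bilevel problem $$\text{(SBLP)}\qquad \min f(x)\quad\text{subject to } x\in\mathcal S\cap\mathcal C,\qquad \mathcal S=\operatorname{argmin}\{\langle c,x\rangle: x\in\Theta\}.$$ Put $G(x)=c+N(x,\Theta)$ for $x\in\Theta$ and $G(x)=\emptyset$ otherwise, where $N(x,\Theta)$ is the (limiting) normal cone. A local solution $\bar x$ of (SBLP) is called robust if $(\bar x,0)$ is a local minimizer of $(x,y)\mapsto f(x)$ over $\{(x,y): y\in G(x),\ x\in\mathcal C\}$. For a set $\Omega$, a closed convex set $C$ and $x\in\Omega\cap C$ let $\hat N(x,\Omega)=\{x^*:\limsup_{u\to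 x,\,u\in\Omega}\langle x^*,u-x\rangle/\|u-x\|\le 0\}$ (Fréchet normal cone), $\mathcal R(x,C)=\{x^*:\exists p>0,\ x+px^*\in C\}$, $\hat N_C(x,\Omega)=\hat N(x,\Omega\cap C)\cap\mathcal R(x,C)$, and let $N_C(\bar x,\Omega)$ be the set of all limits of sequences $x_k^*\in\hat N_C(x_k,\Omega)$ with $x_k\in\Omega\cap C$, $x_k\to\bar x$. For $\bar x\in\mathcal C$ with $f(\bar x)<\infty$ put $$\partial_{\mathcal C}f(\bar x)=\{x^*:(x^*,-1)\in N_{\mathcal C\times\mathbb R}((\bar x,f(\bar x)),\operatorname{epi}f)\},\qquad \partial^\infty_{\mathcal C}f(\bar x)=\{x^*:(x^*,0)\in N_{\mathcal C\times\mathbb R}((\bar x,f(\bar x)),\operatorname{epi}f)\}.$$ Sets $\{\Omega_1,\Omega_2\}$ are normal-densed in $\{C_1,C_2\}$ at $\bar w$ if, whenever $w_{ik}\to\bar w$ in $\Omega_i\cap C_i$, $w_{ik}^*\in\hat N(w_{ik},\Omega_i\cap C_i)$, $w_{ik}^*\to w_i^*$ ($i=1,2$), $w_k\to\bar w$ in $\Omega_1\cap\Omega_2\cap\operatorname{bd}(C_1\cap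 C_2)$, $w_k^*\in\mathcal R(w_k,C_1\cap C_2)$ and $w_k^*\to w_1^*+w_2^*$, there are $\tilde w_{ik}\to\bar w$ in $\Omega_i\cap C_i$ and $\tilde w_{ik}^*\in\hat N_{C_i}(\tilde w_{ik},\Omega_i)$ with $\tilde w_{ik}^*\to\tilde w_i^*$ ($i=1,2$), $\tilde w_1^*+\tilde w_2^*=w_1^*+w_2^*$, and $\max\{\|\tilde w_1^*\|,\|\tilde w_2^*\|\}>0$ if $\max\{\|w_1^*\|,\|w_2^*\|\}>0$. Let $\bar I_j=\{i\in I_j:\langle a_i,\bar x\rangle=b_i\}$ ($j=1,2$). For $Q\subset I_1\cup I_2$ let $C_Q=\{x:\langle a_i,x\rangle=b_i\ \forall i\in Q,\ \langle a_i,x\rangle<b_i\ \forall i\in (I_1\cup I_2)\setminus Q\}$; for $T\subset I_2$ let $\mathcal T_T=\{u:\langle a_i,u\rangle\le0\ \forall i\in T\}$; and let $\mathcal I_2=\{T\subset\bar I_2: C_{\bar I_1\cup T}\neq\emptyset\}$. Here $\operatorname{cone}$ denotes the convex conic hull (with $\operatorname{cone}\emptyset=\operatorname{span}\emptyset=\{0\}$).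 **Theorem.** Let $\bar x$ be a robust local solution of (SBLP) with $f(\bar x)<\infty$, and suppose that $\operatorname{epi}f\cap(\mathcal C\times\mathbb R)$ is locally closed around $(\bar x,f(\bar x))$ (that is, $f$ is lower semicontinuous with respect to $\mathcal C$ around $\bar x$). Assume (i) $[-\partial^\infty_{\mathcal C}f(\bar x)]\cap\big(\operatorname{cone}\{a_i:i\in\bar I_2\}+\operatorname{span}\{a_i:i\in\bar I_1\}\big)\cap\bigcup_{T\in\mathcal I_2}\mathcal T_T=\{0\}$; (ii) $\{\Omega_1,\Omega_2\}$ are normal-densed in $\{\mathcal C\times\mathbb R^{n+1},\mathcal C\times\mathbb R^{n+1}\}$ at $(\bar x,0,f(\bar x))$, where $\Omega_1=\{(x,y,z):(x,z)\in\operatorname{epi}f,\ y\in\mathbb R^n\}$ and $\Omega_2=\operatorname{gph}G\times\mathbb R$. Then $$0\in\partial_{\mathcal C}f(\bar x)+\big(\operatorname{cone}\{a_i:i\in\bar I_2\}+\operatorname{span}\{a_i:i\in\bar I_1\}\big)\cap\bigcup_{T\in\mathcal I_2}\mathcal T_T.$$ -/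

import Mathlib

open Filter Topology
open scoped Pointwise

noncomputable section

namespace SimpleBilevel

section NormalCones

variable {H : Type*} [NormedAddCommGroup H] [InnerProductSpace ℝ H]

/-- The Fréchet normal cone `N̂(x̄, Ω)` at a point `x̄ ∈ Ω`: the upper limit of
`⟪v, x - x̄⟫ / ‖x - x̄‖` as `x → x̄` inside `Ω` is at most `0`. -/
def frechetNormalCone (xbar : H) (Ω : Set H) : Set H :=
  {v | ∀ ε : ℝ, 0 < ε → ∀ᶠ x in 𝓝[Ω] xbar, inner ℝ v (x - xbar) ≤ ε * ‖x - xbar‖}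

/-- The cone `R(x̄, Ω) = {v | ∃ p > 0, x̄ + p v ∈ Ω}`. -/
def radialCone (xbar : H) (Ω : Set H) : Set H :=
  {v | ∃ p : ℝ, 0 < p ∧ xbar + p • v ∈ Ω}

/-- The Fréchet normal cone `N̂_C(x̄, Ω)` to `Ω` at `x̄ ∈ Ω ∩ C` with respect to `C`. -/
def frechetNormalConeWrt (C : Set H) (xbar : H) (Ω : Set H) : Set H :=
  {v | v ∈ radialCone xbar C ∧ v ∈ frechetNormalCone xbar (Ω ∩ C)}

/-- The limiting normal cone `N_C(x̄, Ω)` to `Ω` at `x̄` with respect to `C`: the sequential outer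
limit of `N̂_C(x, Ω)` as `x → x̄`, `x ∈ Ω ∩ C`. -/
def limitingNormalConeWrt (C : Set H) (xbar : H) (Ω : Set H) : Set H :=
  {v | ∃ x w : ℕ → H, (∀ k, x k ∈ Ω ∩ C) ∧ Tendsto x atTop (𝓝 xbar) ∧
    (∀ k, w k ∈ frechetNormalConeWrt C (x k) Ω) ∧ Tendsto w atTop (𝓝 v)}

/-- The set `Π(x, Ω)` of Euclidean projections of `x` onto `Ω`. -/
def projectors (x : H) (Ω : Set H) : Set H :=
  {u | u ∈ Ω ∧ ‖u - x‖ = Metric.infDist x Ω}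

/-- The limiting normal cone `N(x̄, Ω)`: the sequential outer limit of `cone [x - Π(x, Ω)]`
as `x → x̄`. -/
def limitingNormalCone (xbar : H) (Ω : Set H) : Set H :=
  {v | ∃ x w : ℕ → H, Tendsto x atTop (𝓝 xbar) ∧
    (∀ k, ∃ t : ℝ, 0 ≤ t ∧ ∃ u ∈ projectors (x k) Ω, w k = t • (x k - u)) ∧
    Tendsto w atTop (𝓝 v)}

/-- `{Ω₁, Ω₂}` are normal-densed in `{C₁, C₂}` at `x̄`. -/
def NormalDensed (Ω₁ Ω₂ C₁ C₂ : Set H) (xbar : H) : Prop :=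
  ∀ (x₁ x₂ x v₁ v₂ v : ℕ → H) (w₁ w₂ : H),
    (∀ k, x₁ k ∈ Ω₁ ∩ C₁) → Tendsto x₁ atTop (𝓝 xbar) →
    (∀ k, x₂ k ∈ Ω₂ ∩ C₂) → Tendsto x₂ atTop (𝓝 xbar) →
    (∀ k, x k ∈ (Ω₁ ∩ Ω₂) ∩ frontier (C₁ ∩ C₂)) → Tendsto x atTop (𝓝 xbar) →
    (∀ k, v₁ k ∈ frechetNormalCone (x₁ k) (Ω₁ ∩ C₁)) →
    (∀ k, v₂ k ∈ frechetNormalCone (x₂ k) (Ω₂ ∩ C₂)) →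
    (∀ k, v k ∈ radialCone (x k) (C₁ ∩ C₂)) →
    Tendsto v₁ atTop (𝓝 w₁) → Tendsto v₂ atTop (𝓝 w₂) → Tendsto v atTop (𝓝 (w₁ + w₂)) →
    ∃ (y₁ y₂ u₁ u₂ : ℕ → H) (z₁ z₂ : H),
      (∀ k, y₁ k ∈ Ω₁ ∩ C₁) ∧ Tendsto y₁ atTop (𝓝 xbar) ∧
      (∀ k, y₂ k ∈ Ω₂ ∩ C₂) ∧ Tendsto y₂ atTop (𝓝 xbar) ∧
      (∀ k, u₁ k ∈ frechetNormalConeWrt C₁ (y₁ k) Ω₁) ∧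
      (∀ k, u₂ k ∈ frechetNormalConeWrt C₂ (y₂ k) Ω₂) ∧
      Tendsto u₁ atTop (𝓝 z₁) ∧ Tendsto u₂ atTop (𝓝 z₂) ∧
      z₁ + z₂ = w₁ + w₂ ∧
      (0 < max ‖w₁‖ ‖w₂‖ → 0 < max ‖z₁‖ ‖z₂‖)

end NormalCones

section Subdifferentials

variable {H : Type*} [NormedAddCommGroup H] [InnerProductSpace ℝ H]

/-- The epigraph of `f : H → ℝ ∪ {∞}`, in the Euclidean product `H × ℝ`. -/
def epigraph (f : H → WithTop ℝ) : Set (WithLp 2 (H × ℝ)) :=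
  {p | f p.fst ≤ (p.snd : WithTop ℝ)}

/-- The set `C × F` in the Euclidean product `H × F`. -/
def cylinder (F : Type*) (C : Set H) : Set (WithLp 2 (H × F)) :=
  {p | p.fst ∈ C}

/-- The limiting subdifferential `∂_C f(x̄)` with respect to `C` (empty if `x̄ ∉ dom f ∩ C`). -/
def limitingSubdiffWrt (C : Set H) (f : H → WithTop ℝ) (xbar : H) : Set H :=
  {v | xbar ∈ C ∧ ∃ r : ℝ, f xbar = (r : WithTop ℝ) ∧
    WithLp.toLp 2 (v, (-1 : ℝ)) ∈
      limitingNormalConeWrt (cylinder ℝ C) (WithLp.toLp 2 (xbar, r)) (epigraph f)}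

/-- The horizon subdifferential `∂^∞_C f(x̄)` with respect to `C` (empty if `x̄ ∉ dom f ∩ C`). -/
def horizonSubdiffWrt (C : Set H) (f : H → WithTop ℝ) (xbar : H) : Set H :=
  {v | xbar ∈ C ∧ ∃ r : ℝ, f xbar = (r : WithTop ℝ) ∧
    WithLp.toLp 2 (v, (0 : ℝ)) ∈
      limitingNormalConeWrt (cylinder ℝ C) (WithLp.toLp 2 (xbar, r)) (epigraph f)}

/-- `epi f_C = epi f ∩ (C × ℝ)` is locally closed around `(x̄, r)`. -/
def LocallyLscWrt (C : Set H) (f : H → WithTop ℝ) (xbar : H) (r : ℝ) : Prop :=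
  ∃ ε : ℝ, 0 < ε ∧
    IsClosed (epigraph f ∩ cylinder ℝ C ∩ Metric.closedBall (WithLp.toLp 2 (xbar, r)) ε)

end Subdifferentials

section Problem

variable {n ℓ₁ ℓ₂ : ℕ}

/-- The polyhedron `Θ = {x | ⟪a_i, x⟫ ≤ b_i, i ∈ I₁}`. -/
def Theta (a₁ : Fin ℓ₁ → EuclideanSpace ℝ (Fin n)) (b : Fin ℓ₁ → ℝ) :
    Set (EuclideanSpace ℝ (Fin n)) :=
  {x | ∀ i, inner ℝ (a₁ i) x ≤ b i}

/-- The polyhedral cone `{x | ⟪a_i, x⟫ ≤ 0, i ∈ T}`. -/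
def polarT (a₂ : Fin ℓ₂ → EuclideanSpace ℝ (Fin n)) (T : Set (Fin ℓ₂)) :
    Set (EuclideanSpace ℝ (Fin n)) :=
  {x | ∀ i ∈ T, inner ℝ (a₂ i) x ≤ 0}

/-- The polyhedral cone `C = {x | ⟪a_i, x⟫ ≤ 0, i ∈ I₂}`. -/
def coneC (a₂ : Fin ℓ₂ → EuclideanSpace ℝ (Fin n)) : Set (EuclideanSpace ℝ (Fin n)) :=
  {x | ∀ i, inner ℝ (a₂ i) x ≤ 0}

/-- The active index set `I₁(x)` of `Θ`. -/
def active₁ (a₁ : Fin ℓ₁ → EuclideanSpace ℝ (Fin n)) (b : Fin ℓ₁ → ℝ)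
    (x : EuclideanSpace ℝ (Fin n)) : Set (Fin ℓ₁) :=
  {i | inner ℝ (a₁ i) x = b i}

/-- The active index set `I₂(x)` of `C`. -/
def active₂ (a₂ : Fin ℓ₂ → EuclideanSpace ℝ (Fin n)) (x : EuclideanSpace ℝ (Fin n)) :
    Set (Fin ℓ₂) :=
  {i | inner ℝ (a₂ i) x = 0}

/-- The set `C_Q`, `Q = Q₁ ∪ Q₂` with `Q₁ ⊆ I₁`, `Q₂ ⊆ I₂`: the points at which the constraints
with index in `Q` hold with equality and all the other ones strictly. -/
def stratum (a₁ : Fin ℓ₁ → EuclideanSpace ℝ (Fin n)) (b : Fin ℓ₁ → ℝ)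
    (a₂ : Fin ℓ₂ → EuclideanSpace ℝ (Fin n)) (Q₁ : Set (Fin ℓ₁)) (Q₂ : Set (Fin ℓ₂)) :
    Set (EuclideanSpace ℝ (Fin n)) :=
  {x | (∀ i ∈ Q₁, inner ℝ (a₁ i) x = b i) ∧ (∀ i ∈ Q₂, inner ℝ (a₂ i) x = 0) ∧
    (∀ i ∉ Q₁, inner ℝ (a₁ i) x < b i) ∧ (∀ i ∉ Q₂, inner ℝ (a₂ i) x < 0)}

/-- The family `𝓘₂ = {T ⊆ I₂(x̄) | C_{I₁(x̄) ∪ T} ≠ ∅}`. -/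
def family₂ (a₁ : Fin ℓ₁ → EuclideanSpace ℝ (Fin n)) (b : Fin ℓ₁ → ℝ)
    (a₂ : Fin ℓ₂ → EuclideanSpace ℝ (Fin n)) (xbar : EuclideanSpace ℝ (Fin n)) :
    Set (Set (Fin ℓ₂)) :=
  {T | T ⊆ active₂ a₂ xbar ∧ (stratum a₁ b a₂ (active₁ a₁ b xbar) T).Nonempty}

/-- `(cone {a_i | i ∈ I₂(x̄)} + span {a_i | i ∈ I₁(x̄)}) ∩ ⋃_{T ∈ 𝓘₂} {x | ⟪a_i, x⟫ ≤ 0, i ∈ T}`. -/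
def multiplierSet (a₁ : Fin ℓ₁ → EuclideanSpace ℝ (Fin n)) (b : Fin ℓ₁ → ℝ)
    (a₂ : Fin ℓ₂ → EuclideanSpace ℝ (Fin n)) (xbar : EuclideanSpace ℝ (Fin n)) :
    Set (EuclideanSpace ℝ (Fin n)) :=
  ((PointedCone.hull ℝ (a₂ '' active₂ a₂ xbar) : Set (EuclideanSpace ℝ (Fin n))) +
      (Submodule.span ℝ (a₁ '' active₁ a₁ b xbar) : Set (EuclideanSpace ℝ (Fin n)))) ∩
    ⋃ T ∈ family₂ a₁ b a₂ xbar, polarT a₂ T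

/-- The set-valued map `x ↦ G(x) = c + N(x, Θ)` (with `N(x, Θ) = ∅` for `x ∉ Θ`). -/
def mapG (a₁ : Fin ℓ₁ → EuclideanSpace ℝ (Fin n)) (b : Fin ℓ₁ → ℝ)
    (c : EuclideanSpace ℝ (Fin n)) (x : EuclideanSpace ℝ (Fin n)) :
    Set (EuclideanSpace ℝ (Fin n)) :=
  {y | x ∈ Theta a₁ b ∧ ∃ v ∈ limitingNormalCone x (Theta a₁ b), y = c + v}

/-- The solution set of the lower level problem: minimize `⟪c, x⟫` over `Θ`. -/
def lowerSolutions (a₁ : Fin ℓ₁ → EuclideanSpace ℝ (Fin n)) (b : Fin ℓ₁ → ℝ)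
    (c : EuclideanSpace ℝ (Fin n)) : Set (EuclideanSpace ℝ (Fin n)) :=
  {x | x ∈ Theta a₁ b ∧ ∀ y ∈ Theta a₁ b, inner ℝ c x ≤ inner ℝ c y}

/-- `x̄` is a local solution of the simple bilevel problem: minimize `f` over the points of `C`
that solve the lower level problem. -/
def IsLocalSolution (a₁ : Fin ℓ₁ → EuclideanSpace ℝ (Fin n)) (b : Fin ℓ₁ → ℝ)
    (a₂ : Fin ℓ₂ → EuclideanSpace ℝ (Fin n)) (c : EuclideanSpace ℝ (Fin n))
    (f : EuclideanSpace ℝ (Fin n) → WithTop ℝ) (xbar : EuclideanSpace ℝ (Fin n)) : Prop :=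
  xbar ∈ lowerSolutions a₁ b c ∩ coneC a₂ ∧
    IsLocalMinOn f (lowerSolutions a₁ b c ∩ coneC a₂) xbar

/-- `x̄` is a robust local solution: a local solution such that `(x̄, 0)` is a local solution of the
problem of minimizing `f̃(x, y) = f(x)` subject to `y ∈ G(x)` and `x ∈ C`. -/
def IsRobustLocalSolution (a₁ : Fin ℓ₁ → EuclideanSpace ℝ (Fin n)) (b : Fin ℓ₁ → ℝ)
    (a₂ : Fin ℓ₂ → EuclideanSpace ℝ (Fin n)) (c : EuclideanSpace ℝ (Fin n))
    (f : EuclideanSpace ℝ (Fin n) → WithTop ℝ) (xbar : EuclideanSpace ℝ (Fin n)) : Prop :=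
  IsLocalSolution a₁ b a₂ c f xbar ∧
    (0 ∈ mapG a₁ b c xbar ∧ xbar ∈ coneC a₂) ∧
    IsLocalMinOn (fun p : EuclideanSpace ℝ (Fin n) × EuclideanSpace ℝ (Fin n) => f p.1)
      {p | p.2 ∈ mapG a₁ b c p.1 ∧ p.1 ∈ coneC a₂} (xbar, 0)

/-- `Ω₁ = {(x, y, z) | (x, z) ∈ epi f, y ∈ ℝⁿ}`. -/
def Omega₁ (f : EuclideanSpace ℝ (Fin n) → WithTop ℝ) :
    Set (WithLp 2 (EuclideanSpace ℝ (Fin n) × WithLp 2 (EuclideanSpace ℝ (Fin n) × ℝ))) :=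
  {p | WithLp.toLp 2 (p.fst, p.snd.snd) ∈ epigraph f}

/-- `Ω₂ = gph G × ℝ`. -/
def Omega₂ (a₁ : Fin ℓ₁ → EuclideanSpace ℝ (Fin n)) (b : Fin ℓ₁ → ℝ)
    (c : EuclideanSpace ℝ (Fin n)) :
    Set (WithLp 2 (EuclideanSpace ℝ (Fin n) × WithLp 2 (EuclideanSpace ℝ (Fin n) × ℝ))) :=
  {p | p.snd.fst ∈ mapG a₁ b c p.fst}

end Problem

end SimpleBilevel

end

/-! Write K for `faceCone`. Near x̄ the set x̄ + K lies in the face of Θ through x̄, on which ⟨c, ·⟩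
is constant, so it consists of lower-level solutions; hence x̄ minimizes f locally over (x̄ + K) ∩
C. The constraint x - x̄ ∈ K is moved into the objective while x ∈ C is kept: minimize z + (k/2)
dist(x - x̄, K)² + ½‖x - x̄‖² over the part of epi f ∩ (C × ℝ) near (x̄, f(x̄))
(`exists_penalization`). The minimizers (x_k, z_k) tend to (x̄, f(x̄)). With q_k a projection of x_k
- x̄ onto K and p_k = k(x_k - x̄ - q_k), the vector (-(p_k + x_k - x̄), -1) is a Fréchet normal to
epi f ∩ (C × ℝ). Two facts make this normal usable. It is radial for C
(`eventually_mem_radialCone`), so it is a normal with respect to C × ℝ. And p_k lies in the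
multiplier set (`sub_mem_polarMultipliers`): as a projection residual it is in the polar of K, which
Farkas' lemma turns into cone plus span, and the constraints of C tight at q_k supply the index set
T. If (p_k) has a bounded subsequence, a limit v gives -v ∈ ∂_C f(x̄) with v a multiplier. Otherwise
‖p_k‖ → ∞, and normalizing yields a unit multiplier whose negative is a horizon subgradient,
contradicting (i). -/

namespace SimpleBilevel

/-! ### Farkas' lemma. -/

section Farkas

variable {E : Type*} [NormedAddCommGroup E] [InnerProductSpace ℝ E]

/-- **Farkas' lemma**: a vector that is nonpositive on the polar cone of a finite family is a
nonnegative combination of the family. -/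
theorem exists_nonneg_sum_smul_of_forall_inner_nonpos {ι : Type*} (s : Finset ι) (a : ι → E)
    (v : E) (h : ∀ x : E, (∀ i ∈ s, inner ℝ (a i) x ≤ 0) → inner ℝ v x ≤ 0) :
    ∃ l : ι → ℝ, (∀ i, 0 ≤ l i) ∧ v = ∑ i ∈ s, l i • a i := by
  classical
  induction s using Finset.induction_on generalizing a v with
  | empty =>
    refine ⟨fun _ => 0, fun _ => le_rfl, ?_⟩
    have := h v (by simp)
    simpa using this
  | insert j s hj ih =>
    by_cases hs : ∀ x : E, (∀ i ∈ s, inner ℝ (a i) x ≤ 0) → inner ℝ v x ≤ 0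
    · obtain ⟨l, hl, hv⟩ := ih a v hs
      refine ⟨fun i => if i = j then 0 else l i, fun i => ?_, ?_⟩
      · dsimp only
        split_ifs
        exacts [le_rfl, hl i]
      · rw [Finset.sum_insert hj, hv]
        simp only [if_true, zero_smul, zero_add]
        refine Finset.sum_congr rfl fun i hi => ?_
        rw [if_neg (ne_of_mem_of_not_mem hi hj)]
    · push Not at hs
      obtain ⟨x₀, hx₀, hv₀⟩ := hs
      have hj₀ : 0 < inner ℝ (a j) x₀ := by
        by_contra hcon
        refine hv₀.not_ge (h x₀ fun i hi => ?_)
        rcases Finset.mem_insert.1 hi with rfl | hi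
        exacts [not_lt.1 hcon, hx₀ i hi]
      set m := inner ℝ (a j) x₀ with hm
      -- Pairing u - (⟨u, x₀⟩/m) a_j with x equals pairing u with the oblique projection of x along
      -- x₀ onto the hyperplane orthogonal to a_j. There the constraint `j` holds with equality, so
      -- `h` applies with only the constraints in `s`.
      obtain ⟨l, hl, hv⟩ := ih (fun i => a i - (inner ℝ (a i) x₀ / m) • a j)
        (v - (inner ℝ v x₀ / m) • a j) (by
          intro x hx
          have key := h (x - (inner ℝ (a j) x / m) • x₀) (by
            intro i hi
            rcases Finset.mem_insert.1 hi with rfl | hi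
            · rw [inner_sub_right, inner_smul_right, ← hm, div_mul_cancel₀ _ hj₀.ne', sub_self]
            · have := hx i hi
              rw [inner_sub_left, inner_smul_left] at this
              rw [inner_sub_right, inner_smul_right]
              simp only [conj_trivial] at this
              refine le_trans (le_of_eq ?_) this
              ring)
          rw [inner_sub_right, inner_smul_right] at key
          rw [inner_sub_left, inner_smul_left]
          simp only [conj_trivial]
          refine le_trans (le_of_eq ?_) key
          ring)
      -- The coefficient of a_j collects all correction terms; it is nonnegative because ⟨v, x₀⟩ > 0
      -- while ⟨a_i, x₀⟩ ≤ 0 on `s`.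
      refine ⟨fun i => if i = j then inner ℝ v x₀ / m - ∑ i ∈ s, l i * (inner ℝ (a i) x₀ / m)
        else l i, fun i => ?_, ?_⟩
      · dsimp only
        split_ifs
        · have h1 : ∑ i ∈ s, l i * (inner ℝ (a i) x₀ / m) ≤ 0 :=
            Finset.sum_nonpos fun i hi => mul_nonpos_of_nonneg_of_nonpos (hl i)
              (div_nonpos_of_nonpos_of_nonneg (hx₀ i hi) hj₀.le)
          have h2 : 0 ≤ inner ℝ v x₀ / m := (div_pos hv₀ hj₀).le
          linarith
        · exact hl i
      · rw [Finset.sum_insert hj]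
        beta_reduce
        rw [if_pos rfl]
        have h1 : ∑ i ∈ s, (if i = j then inner ℝ v x₀ / m -
            ∑ i ∈ s, l i * (inner ℝ (a i) x₀ / m) else l i) • a i = ∑ i ∈ s, l i • a i :=
          Finset.sum_congr rfl fun i hi => by rw [if_neg (ne_of_mem_of_not_mem hi hj)]
        rw [h1]
        simp only [smul_sub, Finset.sum_sub_distrib, smul_smul, ← Finset.sum_smul] at hv
        rw [sub_smul]
        refine (eq_add_of_sub_eq hv).trans ?_
        abel

end Farkas

/-! ### Local geometry of Θ and C at x̄. -/

section Polyhedra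

variable {n ℓ₁ ℓ₂ : ℕ} (a₁ : Fin ℓ₁ → EuclideanSpace ℝ (Fin n)) (b : Fin ℓ₁ → ℝ)
  (a₂ : Fin ℓ₂ → EuclideanSpace ℝ (Fin n)) (c xbar : EuclideanSpace ℝ (Fin n))

/-- The directions that keep the active constraints of `Θ` active and are tangent to `C`. -/
def faceCone : Set (EuclideanSpace ℝ (Fin n)) :=
  {d | (∀ i ∈ active₁ a₁ b xbar, inner ℝ (a₁ i) d = 0) ∧
    ∀ i ∈ active₂ a₂ xbar, inner ℝ (a₂ i) d ≤ 0}

theorem convex_faceCone : Convex ℝ (faceCone a₁ b a₂ xbar) := by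
  rintro x ⟨hx₁, hx₂⟩ y ⟨hy₁, hy₂⟩ s t hs ht -
  refine ⟨fun i hi => ?_, fun i hi => ?_⟩
  · rw [inner_add_right, inner_smul_right, inner_smul_right, hx₁ i hi, hy₁ i hi]
    simp
  · rw [inner_add_right, inner_smul_right, inner_smul_right]
    have := mul_nonpos_of_nonneg_of_nonpos hs (hx₂ i hi)
    have := mul_nonpos_of_nonneg_of_nonpos ht (hy₂ i hi)
    linarith

theorem isClosed_faceCone : IsClosed (faceCone a₁ b a₂ xbar) := by
  simp only [faceCone, Set.ofPred_and, Set.ofPred_forall]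
  exact (isClosed_iInter fun i => isClosed_iInter fun _ =>
      isClosed_eq (by fun_prop) continuous_const).inter
    (isClosed_iInter fun i => isClosed_iInter fun _ =>
      isClosed_le (by fun_prop) continuous_const)

theorem zero_mem_faceCone : 0 ∈ faceCone a₁ b a₂ xbar := by
  simp [faceCone]

theorem add_mem_faceCone {x y : EuclideanSpace ℝ (Fin n)} (hx : x ∈ faceCone a₁ b a₂ xbar)
    (hy : y ∈ faceCone a₁ b a₂ xbar) : x + y ∈ faceCone a₁ b a₂ xbar := by
  refine ⟨fun i hi => ?_, fun i hi => ?_⟩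
  · rw [inner_add_right, hx.1 i hi, hy.1 i hi, add_zero]
  · rw [inner_add_right]
    linarith [hx.2 i hi, hy.2 i hi]

/-- The polar of `faceCone` intersected with `⋃_{T ∈ 𝓘₂} {x | ⟪a_i, x⟫ ≤ 0, i ∈ T}`. -/
def polarMultipliers : Set (EuclideanSpace ℝ (Fin n)) :=
  {p | ∀ w ∈ faceCone a₁ b a₂ xbar, inner ℝ p w ≤ 0} ∩
    ⋃ T ∈ family₂ a₁ b a₂ xbar, polarT a₂ T

theorem isClosed_polarT (T : Set (Fin ℓ₂)) : IsClosed (polarT a₂ T) := by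
  simp only [polarT, Set.ofPred_forall]
  exact isClosed_iInter fun i => isClosed_iInter fun _ =>
    isClosed_le (by fun_prop) continuous_const

/-- In polar form closedness is immediate, there being finitely many T; limits of multipliers are
therefore taken here, before passing to cone plus span. -/
theorem isClosed_polarMultipliers : IsClosed (polarMultipliers a₁ b a₂ xbar) := by
  refine IsClosed.inter ?_ (Set.Finite.isClosed_biUnion (Set.toFinite _)
    fun T _ => isClosed_polarT a₂ T)
  simp only [Set.ofPred_forall]
  exact isClosed_iInter fun i => isClosed_iInter fun _ =>
    isClosed_le (by fun_prop) continuous_const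

theorem smul_mem_polarMultipliers {t : ℝ} (ht : 0 ≤ t) {p : EuclideanSpace ℝ (Fin n)}
    (hp : p ∈ polarMultipliers a₁ b a₂ xbar) : t • p ∈ polarMultipliers a₁ b a₂ xbar := by
  obtain ⟨hp₁, hp₂⟩ := hp
  simp only [Set.mem_iUnion] at hp₂
  obtain ⟨T, hT, hpT⟩ := hp₂
  refine ⟨fun w hw => ?_, Set.mem_biUnion hT fun i hi => ?_⟩
  · rw [inner_smul_left]
    exact mul_nonpos_of_nonneg_of_nonpos ht (hp₁ w hw)
  · rw [inner_smul_right]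
    exact mul_nonpos_of_nonneg_of_nonpos ht (hpT i hi)

theorem polarMultipliers_subset_multiplierSet :
    polarMultipliers a₁ b a₂ xbar ⊆ multiplierSet a₁ b a₂ xbar := by
  classical
  refine Set.inter_subset_inter_left _ fun p hp => ?_
  obtain ⟨l, hl, hpl⟩ := exists_nonneg_sum_smul_of_forall_inner_nonpos
    -- Each equality ⟨a_i, x⟩ = 0 from Θ enters twice, through a_i and -a_i; the two copies together
    -- produce the span.
    (Finset.univ.filter fun i : Fin ℓ₂ ⊕ Fin ℓ₁ ⊕ Fin ℓ₁ =>
      Sum.elim (· ∈ active₂ a₂ xbar)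
        (Sum.elim (· ∈ active₁ a₁ b xbar) (· ∈ active₁ a₁ b xbar)) i)
    (Sum.elim a₂ (Sum.elim a₁ (-a₁))) p (by
      intro x hx
      refine hp x ⟨fun i hi => le_antisymm ?_ ?_, fun i hi => ?_⟩
      · simpa using hx (Sum.inr (Sum.inl i)) (by simpa using hi)
      · simpa using hx (Sum.inr (Sum.inr i)) (by simpa using hi)
      · simpa using hx (Sum.inl i) (by simpa using hi))
  have key : p ∈ PointedCone.hull ℝ (a₂ '' active₂ a₂ xbar) ⊔
      PointedCone.ofSubmodule (Submodule.span ℝ (a₁ '' active₁ a₁ b xbar)) := by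
    rw [hpl]
    refine Submodule.sum_mem _ fun i hi => ?_
    rw [Finset.mem_filter] at hi
    rcases i with i | i | i
    · exact Submodule.mem_sup_left (Submodule.smul_mem _ (⟨l _, hl _⟩ : {t : ℝ // 0 ≤ t})
        (Submodule.subset_span ⟨i, hi.2, rfl⟩))
    · exact Submodule.mem_sup_right (Submodule.smul_mem (Submodule.span ℝ _) _
        (Submodule.subset_span ⟨i, hi.2, rfl⟩))
    · exact Submodule.mem_sup_right (Submodule.smul_mem (Submodule.span ℝ _) _
        (Submodule.neg_mem _ (Submodule.subset_span ⟨i, hi.2, rfl⟩)))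
  obtain ⟨y, hy, z, hz, rfl⟩ := Submodule.mem_sup.1 key
  exact Set.add_mem_add hy hz

variable {a₁ b a₂ c xbar}

/-- The witness in the stratum is x̄ + s q for small s > 0: the constraints active at x̄ behave as
they do along q, and the inactive ones stay strict. -/
theorem active_mem_family₂ (hΘ : xbar ∈ Theta a₁ b) (hC : xbar ∈ coneC a₂)
    {q : EuclideanSpace ℝ (Fin n)} (hq : q ∈ faceCone a₁ b a₂ xbar) :
    {i | i ∈ active₂ a₂ xbar ∧ inner ℝ (a₂ i) q = 0} ∈ family₂ a₁ b a₂ xbar := by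
  refine ⟨fun i hi => hi.1, ?_⟩
  have hlim : ∀ a : EuclideanSpace ℝ (Fin n),
      Tendsto (fun s : ℝ => inner ℝ a (xbar + s • q)) (𝓝[>] 0) (𝓝 (inner ℝ a xbar)) := by
    intro a
    have : Continuous fun s : ℝ => inner ℝ a (xbar + s • q) := by fun_prop
    simpa using (this.tendsto 0).mono_left nhdsWithin_le_nhds
  have h₁ : ∀ᶠ s : ℝ in 𝓝[>] 0, ∀ i, i ∉ active₁ a₁ b xbar →
      inner ℝ (a₁ i) (xbar + s • q) < b i :=
    eventually_all.2 fun i => by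
      by_cases hi : i ∈ active₁ a₁ b xbar
      · exact Eventually.of_forall fun s h => absurd hi h
      · filter_upwards [(hlim (a₁ i)).eventually_lt_const (lt_of_le_of_ne (hΘ i) hi)]
          with s hs _ using hs
  have h₂ : ∀ᶠ s : ℝ in 𝓝[>] 0, ∀ i, i ∉ active₂ a₂ xbar →
      inner ℝ (a₂ i) (xbar + s • q) < 0 :=
    eventually_all.2 fun i => by
      by_cases hi : i ∈ active₂ a₂ xbar
      · exact Eventually.of_forall fun s h => absurd hi h
      · filter_upwards [(hlim (a₂ i)).eventually_lt_const (lt_of_le_of_ne (hC i) hi)]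
          with s hs _ using hs
  obtain ⟨s, hs₁, hs₂, hs⟩ := (h₁.and (h₂.and self_mem_nhdsWithin)).exists
  refine ⟨xbar + s • q, fun i hi => ?_, fun i hi => ?_, hs₁, fun i hi => ?_⟩
  · rw [inner_add_right, inner_smul_right, hq.1 i hi, mul_zero, add_zero]
    exact hi
  · rw [inner_add_right, inner_smul_right, hi.2, mul_zero, add_zero]
    exact hi.1
  · by_cases hia : i ∈ active₂ a₂ xbar
    · rw [inner_add_right, inner_smul_right, show inner ℝ (a₂ i) xbar = 0 from hia, zero_add]
      exact mul_neg_of_pos_of_neg hs (lt_of_le_of_ne (hq.2 i hia) fun h => hi ⟨hia, h⟩)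
    · exact hs₂ i hia

theorem eventually_inactive₂_neg (hC : xbar ∈ coneC a₂) :
    ∀ᶠ x in 𝓝 xbar, ∀ i, i ∉ active₂ a₂ xbar → inner ℝ (a₂ i) x < 0 :=
  eventually_all.2 fun i => by
    by_cases hi : i ∈ active₂ a₂ xbar
    · exact Eventually.of_forall fun s h => absurd hi h
    · have : Continuous fun x : EuclideanSpace ℝ (Fin n) => inner ℝ (a₂ i) x := by fun_prop
      filter_upwards [(this.tendsto xbar).eventually_lt_const (lt_of_le_of_ne (hC i) hi)]
        with s hs _ using hs

theorem eventually_inactive₁_lt (hΘ : xbar ∈ Theta a₁ b) :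
    ∀ᶠ x in 𝓝 xbar, ∀ i, i ∉ active₁ a₁ b xbar → inner ℝ (a₁ i) x < b i :=
  eventually_all.2 fun i => by
    by_cases hi : i ∈ active₁ a₁ b xbar
    · exact Eventually.of_forall fun s h => absurd hi h
    · have : Continuous fun x : EuclideanSpace ℝ (Fin n) => inner ℝ (a₁ i) x := by fun_prop
      filter_upwards [(this.tendsto xbar).eventually_lt_const (lt_of_le_of_ne (hΘ i) hi)]
        with s hs _ using hs

theorem eventually_mem_Theta (hΘ : xbar ∈ Theta a₁ b) :
    ∀ᶠ x in 𝓝 xbar, (∀ i ∈ active₁ a₁ b xbar, inner ℝ (a₁ i) (x - xbar) = 0) →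
      x ∈ Theta a₁ b := by
  filter_upwards [eventually_inactive₁_lt hΘ] with x hx h i
  by_cases hi : i ∈ active₁ a₁ b xbar
  · have := h i hi
    rw [inner_sub_right, sub_eq_zero] at this
    exact (this.trans hi).le
  · exact (hx i hi).le

/-- The objective of the lower level problem is constant on the face of `Θ` through a solution. -/
theorem inner_eq_zero_of_mem_lowerSolutions (hS : xbar ∈ lowerSolutions a₁ b c)
    {d : EuclideanSpace ℝ (Fin n)} (hd : ∀ i ∈ active₁ a₁ b xbar, inner ℝ (a₁ i) d = 0) :
    inner ℝ c d = 0 := by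
  have hlim : ∀ e : EuclideanSpace ℝ (Fin n),
      Tendsto (fun s : ℝ => xbar + s • e) (𝓝[>] 0) (𝓝 xbar) := by
    intro e
    have : Continuous fun s : ℝ => xbar + s • e := by fun_prop
    simpa using (this.tendsto 0).mono_left nhdsWithin_le_nhds
  -- Short steps along such a direction stay in Θ, so optimality gives ⟨c, e⟩ ≥ 0; the conclusion
  -- follows from e = d and e = -d.
  have main : ∀ e : EuclideanSpace ℝ (Fin n),
      (∀ i ∈ active₁ a₁ b xbar, inner ℝ (a₁ i) e = 0) → 0 ≤ inner ℝ c e := by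
    intro e he
    obtain ⟨s, hs, hs0⟩ :=
      (((hlim e).eventually (eventually_mem_Theta hS.1)).and self_mem_nhdsWithin).exists
    have := hS.2 _ (hs fun i hi => by
      rw [add_sub_cancel_left, inner_smul_right, he i hi, mul_zero])
    rw [inner_add_right, inner_smul_right] at this
    exact nonneg_of_mul_nonneg_right (by linarith) hs0
  refine le_antisymm ?_ (main d hd)
  have := main (-d) fun i hi => by rw [inner_neg_right, hd i hi, neg_zero]
  rw [inner_neg_right] at this
  linarith

theorem eventually_mem_lowerSolutions (hS : xbar ∈ lowerSolutions a₁ b c) :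
    ∀ᶠ x in 𝓝 xbar, x - xbar ∈ faceCone a₁ b a₂ xbar → x ∈ lowerSolutions a₁ b c := by
  filter_upwards [eventually_mem_Theta hS.1] with x hx h
  refine ⟨hx h.1, fun y hy => ?_⟩
  have := inner_eq_zero_of_mem_lowerSolutions hS h.1
  rw [inner_sub_right, sub_eq_zero] at this
  exact this.le.trans (hS.2 y hy)

/-- A step of length s leads to (1 - s(t+1)) x + s(t+1) x̄ + s t q. On constraints active at x̄ the
middle term vanishes and the others are nonpositive once s(t+1) < 1; inactive constraints survive
small steps. This is what makes the penalty normals admissible with respect to C. -/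
theorem eventually_mem_radialCone (hC : xbar ∈ coneC a₂) :
    ∀ᶠ x in 𝓝 xbar, x ∈ coneC a₂ → ∀ q ∈ faceCone a₁ b a₂ xbar, ∀ t : ℝ, 0 ≤ t →
      -(t • (x - xbar - q) + (x - xbar)) ∈ radialCone x (coneC a₂) := by
  filter_upwards [eventually_inactive₂_neg hC] with x hx hxC q hq t ht
  set v := -(t • (x - xbar - q) + (x - xbar)) with hv
  have h₁ : ∀ᶠ s : ℝ in 𝓝[>] 0, ∀ i, i ∉ active₂ a₂ xbar → inner ℝ (a₂ i) (x + s • v) < 0 :=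
    eventually_all.2 fun i => by
      by_cases hi : i ∈ active₂ a₂ xbar
      · exact Eventually.of_forall fun s h => absurd hi h
      · have : Continuous fun s : ℝ => inner ℝ (a₂ i) (x + s • v) := by fun_prop
        have hlim : Tendsto (fun s : ℝ => inner ℝ (a₂ i) (x + s • v)) (𝓝[>] 0)
            (𝓝 (inner ℝ (a₂ i) x)) := by
          simpa using (this.tendsto 0).mono_left nhdsWithin_le_nhds
        filter_upwards [hlim.eventually_lt_const (hx i hi)] with s hs _ using hs
  have h₂ : ∀ᶠ s : ℝ in 𝓝[>] 0, s * (t + 1) < 1 := by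
    have : Continuous fun s : ℝ => s * (t + 1) := by fun_prop
    have hlim : Tendsto (fun s : ℝ => s * (t + 1)) (𝓝[>] 0) (𝓝 0) := by
      simpa using (this.tendsto 0).mono_left nhdsWithin_le_nhds
    exact hlim.eventually_lt_const one_pos
  obtain ⟨s, hs₁, hs₂, hs⟩ := (h₁.and (h₂.and self_mem_nhdsWithin)).exists
  refine ⟨s, hs, fun i => ?_⟩
  by_cases hi : i ∈ active₂ a₂ xbar
  · have h0 : inner ℝ (a₂ i) xbar = 0 := hi
    have hxi := hxC i
    have hqi := hq.2 i hi
    simp only [hv, inner_add_right, inner_smul_right, inner_neg_right, inner_sub_right, h0]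
    have e₁ : (1 - s * (t + 1)) * inner ℝ (a₂ i) x ≤ 0 :=
      mul_nonpos_of_nonneg_of_nonpos (by linarith) hxi
    have e₂ : s * t * inner ℝ (a₂ i) q ≤ 0 :=
      mul_nonpos_of_nonneg_of_nonpos (by positivity) hqi
    linarith
  · exact (hs₁ i hi).le

end Polyhedra

/-! ### Quadratic penalization and the normals it produces. -/

section Penalization

variable {H : Type*} [NormedAddCommGroup H] [InnerProductSpace ℝ H]

theorem smul_mem_frechetNormalCone {x v : H} {Ω : Set H} {t : ℝ} (ht : 0 < t)
    (hv : v ∈ frechetNormalCone x Ω) : t • v ∈ frechetNormalCone x Ω := by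
  intro ε hε
  filter_upwards [hv (ε / t) (by positivity)] with u hu
  rw [inner_smul_left]
  calc t * inner ℝ v (u - x) ≤ t * (ε / t * ‖u - x‖) := mul_le_mul_of_nonneg_left hu ht.le
    _ = ε * ‖u - x‖ := by field_simp

theorem smul_mem_radialCone {x v : H} {Ω : Set H} {t : ℝ} (ht : 0 < t)
    (hv : v ∈ radialCone x Ω) : t • v ∈ radialCone x Ω := by
  obtain ⟨p, hp, h⟩ := hv
  refine ⟨p / t, by positivity, ?_⟩
  rwa [smul_smul, div_mul_cancel₀ _ ht.ne']

theorem smul_mem_frechetNormalConeWrt {C : Set H} {x v : H} {Ω : Set H} {t : ℝ} (ht : 0 < t)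
    (hv : v ∈ frechetNormalConeWrt C x Ω) : t • v ∈ frechetNormalConeWrt C x Ω :=
  ⟨smul_mem_radialCone ht hv.1, smul_mem_frechetNormalCone ht hv.2⟩

/-- A proximal normal is a Fréchet normal. -/
theorem mem_frechetNormalCone_of_inner_le_sq {x v : H} {Ω : Set H} (M : ℝ)
    (h : ∀ᶠ u in 𝓝[Ω] x, inner ℝ v (u - x) ≤ M * ‖u - x‖ ^ 2) : v ∈ frechetNormalCone x Ω := by
  intro ε hε
  have hlim : Tendsto (fun u : H => M * ‖u - x‖) (𝓝[Ω] x) (𝓝 0) := by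
    have : Continuous fun u : H => M * ‖u - x‖ := by fun_prop
    simpa using (this.tendsto x).mono_left nhdsWithin_le_nhds
  filter_upwards [h, hlim.eventually_lt_const hε] with u hu hM
  calc inner ℝ v (u - x) ≤ M * ‖u - x‖ * ‖u - x‖ := by rw [mul_assoc, ← sq]; exact hu
    _ ≤ ε * ‖u - x‖ := mul_le_mul_of_nonneg_right hM.le (norm_nonneg _)

/-- The objective of the penalized problem. -/
noncomputable def penalty (K : Set H) (xbar : H) (t : ℝ) (p : WithLp 2 (H × ℝ)) : ℝ :=
  p.snd + t / 2 * Metric.infDist (p.fst - xbar) K ^ 2 + 1 / 2 * ‖p.fst - xbar‖ ^ 2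

theorem continuous_penalty {H : Type*} [NormedAddCommGroup H] (K : Set H) (xbar : H) (t : ℝ) : Continuous (penalty K xbar t) := by
  unfold penalty
  have h₁ : Continuous fun p : WithLp 2 (H × ℝ) => p.fst :=
    continuous_fst.comp (WithLp.prod_continuous_ofLp 2 H ℝ)
  have h₂ : Continuous fun p : WithLp 2 (H × ℝ) => p.snd :=
    continuous_snd.comp (WithLp.prod_continuous_ofLp 2 H ℝ)
  have h₃ : Continuous fun p : WithLp 2 (H × ℝ) => p.fst - xbar := h₁.sub continuous_const
  have h₄ := (Metric.continuous_infDist_pt K).comp h₃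
  exact (h₂.add ((h₄.pow 2).const_mul _)).add ((h₃.norm.pow 2).const_mul _)

/-- The Fréchet normal produced by a local minimizer of the penalized problem. -/
theorem penalty_normal {K : Set H} {xbar q : H} {t : ℝ} (ht : 0 ≤ t) {Ω : Set (WithLp 2 (H × ℝ))}
    {p : WithLp 2 (H × ℝ)} (hq : q ∈ K) (hpq : Metric.infDist (p.fst - xbar) K = ‖p.fst - xbar - q‖)
    (hmin : ∀ᶠ u in 𝓝[Ω] p, penalty K xbar t p ≤ penalty K xbar t u) :
    WithLp.toLp 2 (-(t • (p.fst - xbar - q) + (p.fst - xbar)), (-1 : ℝ)) ∈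
      frechetNormalCone p Ω := by
  -- Freezing `q` replaces the squared distance by a quadratic majorant that is exact at `p`. The
  -- constant is the sum of the two quadratic coefficients t/2 and 1/2.
  refine mem_frechetNormalCone_of_inner_le_sq ((t + 1) / 2) ?_
  filter_upwards [hmin] with u hu
  have h₁ : Metric.infDist (u.fst - xbar) K ≤ ‖u.fst - xbar - q‖ := by
    rw [← dist_eq_norm]
    exact Metric.infDist_le_dist_of_mem hq
  have h₂ : Metric.infDist (u.fst - xbar) K ^ 2 ≤ ‖u.fst - xbar - q‖ ^ 2 :=
    pow_le_pow_left₀ Metric.infDist_nonneg h₁ 2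
  have e₁ : ‖u.fst - xbar - q‖ ^ 2 = ‖p.fst - xbar - q‖ ^ 2 +
      2 * inner ℝ (p.fst - xbar - q) (u.fst - p.fst) + ‖u.fst - p.fst‖ ^ 2 := by
    rw [← norm_add_sq_real]; congr 2; abel
  have e₂ : ‖u.fst - xbar‖ ^ 2 = ‖p.fst - xbar‖ ^ 2 +
      2 * inner ℝ (p.fst - xbar) (u.fst - p.fst) + ‖u.fst - p.fst‖ ^ 2 := by
    rw [← norm_add_sq_real]; congr 2; abel
  have h₃ : ‖u.fst - p.fst‖ ^ 2 ≤ ‖u - p‖ ^ 2 :=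
    pow_le_pow_left₀ (norm_nonneg _) (WithLp.norm_fst_le H (u - p)) 2
  have h₄ := mul_le_mul_of_nonneg_left h₂ (show 0 ≤ t / 2 by linarith)
  have h₅ := mul_le_mul_of_nonneg_left h₃ (show 0 ≤ (t + 1) / 2 by linarith)
  have hinner : inner ℝ (WithLp.toLp 2 (-(t • (p.fst - xbar - q) + (p.fst - xbar)), (-1 : ℝ)))
      (u - p) = -(t * inner ℝ (p.fst - xbar - q) (u.fst - p.fst) +
        inner ℝ (p.fst - xbar) (u.fst - p.fst)) - (u.snd - p.snd) := by
    rw [WithLp.prod_inner_apply]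
    change inner ℝ (-(t • (p.fst - xbar - q) + (p.fst - xbar))) (u.fst - p.fst) +
      inner ℝ (-1 : ℝ) (u.snd - p.snd) = _
    rw [inner_neg_left, inner_add_left, inner_smul_left, inner_neg_left]
    simp
    ring
  unfold penalty at hu
  rw [hpq, e₂] at hu
  rw [e₁] at h₄
  rw [hinner]
  linarith

/-- The variational inequality of the projection, tested at q + w, which stays in K by additivity.
-/
theorem inner_sub_le_zero_of_infDist_eq {K : Set H} (hK : Convex ℝ K)
    (hadd : ∀ x ∈ K, ∀ y ∈ K, x + y ∈ K) {d q : H} (hq : q ∈ K)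
    (hdq : Metric.infDist d K = ‖d - q‖) : ∀ w ∈ K, inner ℝ (d - q) w ≤ 0 := by
  intro w hw
  have h : ‖d - q‖ = ⨅ w : K, ‖d - w‖ := by
    rw [← hdq, Metric.infDist_eq_iInf]
    simp only [dist_eq_norm]
  have := (norm_eq_iInf_iff_real_inner_le_zero hK hq).1 h (q + w) (hadd q hq w hw)
  rwa [add_sub_cancel_left] at this

/-- Minimizers of the penalized problems converge to a point `x̄` that minimizes `f` locally over
`(x̄ + K) ∩ C`, and provide Fréchet normals to the epigraph. -/
theorem exists_penalization [FiniteDimensional ℝ H] {C K : Set H} {f : H → WithTop ℝ} {xbar : H} {r : ℝ}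
    (hr : f xbar = (r : WithTop ℝ)) (hC : xbar ∈ C) (hlsc : LocallyLscWrt C f xbar r)
    (hK : IsClosed K) (h0 : (0 : H) ∈ K)
    (hmin : ∀ᶠ x in 𝓝 xbar, x - xbar ∈ K → x ∈ C → f xbar ≤ f x) :
    ∃ (p : ℕ → WithLp 2 (H × ℝ)) (q : ℕ → H),
      (∀ k, p k ∈ epigraph f ∩ cylinder ℝ C) ∧ Tendsto p atTop (𝓝 (WithLp.toLp 2 (xbar, r))) ∧
      (∀ k, q k ∈ K ∧ Metric.infDist ((p k).fst - xbar) K = ‖(p k).fst - xbar - q k‖) ∧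
      ∀ᶠ k in atTop, WithLp.toLp 2
        (-((k : ℝ) • ((p k).fst - xbar - q k) + ((p k).fst - xbar)), (-1 : ℝ)) ∈
          frechetNormalCone (p k) (epigraph f ∩ cylinder ℝ C) := by
  have : FiniteDimensional ℝ (WithLp 2 (H × ℝ)) :=
    (WithLp.linearEquiv 2 ℝ (H × ℝ)).symm.finiteDimensional
  have : ProperSpace (WithLp 2 (H × ℝ)) := FiniteDimensional.proper_real _
  have : ProperSpace H := FiniteDimensional.proper_real _
  obtain ⟨ε, hε, hclosed⟩ := hlsc
  obtain ⟨δ, hδ, hball⟩ := Metric.eventually_nhds_iff_ball.1 hmin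
  set pbar : WithLp 2 (H × ℝ) := WithLp.toLp 2 (xbar, r) with hpbar
  -- A radius below ε makes the truncated epigraph compact; below δ, it keeps cluster points where
  -- x̄ is minimal.
  obtain ⟨η, hη, hηlt⟩ := exists_between (lt_min hε hδ)
  set D := epigraph f ∩ cylinder ℝ C ∩ Metric.closedBall pbar η with hD
  have hDc : IsCompact D := by
    have : D = (epigraph f ∩ cylinder ℝ C ∩ Metric.closedBall pbar ε) ∩
        Metric.closedBall pbar η := by
      rw [Set.inter_assoc, Set.inter_eq_self_of_subset_right (Metric.closedBall_subset_closedBall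
        (hηlt.le.trans (min_le_left _ _)))]
    rw [this]
    exact (isCompact_closedBall pbar η).inter_left hclosed
  have hpD : pbar ∈ D := ⟨⟨hr.le, hC⟩, Metric.mem_closedBall_self hη.le⟩
  choose p hpmem hpmin using fun k : ℕ =>
    hDc.exists_isMinOn ⟨pbar, hpD⟩ (continuous_penalty K xbar (k : ℝ)).continuousOn
  choose q hqK hq using fun k : ℕ => hK.exists_infDist_eq_dist ⟨0, h0⟩ ((p k).fst - xbar)
  have hval : ∀ k : ℕ, penalty K xbar k (p k) ≤ r := by
    intro k
    refine (hpmin k hpD).trans (le_of_eq ?_)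
    change r + (k : ℝ) / 2 * Metric.infDist (xbar - xbar) K ^ 2 + 1 / 2 * ‖xbar - xbar‖ ^ 2 = r
    rw [sub_self, Metric.infDist_zero_of_mem h0]
    simp
  have hfst : Continuous fun p : WithLp 2 (H × ℝ) => p.fst :=
    continuous_fst.comp (WithLp.prod_continuous_ofLp 2 H ℝ)
  have hsnd : Continuous fun p : WithLp 2 (H × ℝ) => p.snd :=
    continuous_snd.comp (WithLp.prod_continuous_ofLp 2 H ℝ)
  have hsndlow : ∀ k, r - η ≤ (p k).snd := by
    intro k
    have h₁ := (hpmem k).2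
    rw [Metric.mem_closedBall, dist_eq_norm] at h₁
    have h₂ := (WithLp.norm_snd_le H (p k - pbar)).trans h₁
    change ‖(p k).snd - r‖ ≤ η at h₂
    rw [Real.norm_eq_abs] at h₂
    linarith [(abs_le.1 h₂).1]
  -- The penalty value is at most r and z_k ≥ r - η, so the squared distance is at most 2η/k.
  have hdist : Tendsto (fun k => Metric.infDist ((p k).fst - xbar) K ^ 2) atTop (𝓝 0) := by
    refine squeeze_zero' (g := fun k : ℕ => 2 * η / k) (Eventually.of_forall fun k => sq_nonneg _) ?_
      (tendsto_const_div_atTop_nhds_zero_nat _)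
    filter_upwards [eventually_gt_atTop 0] with k hk
    have hk' : (0 : ℝ) < k := Nat.cast_pos.2 hk
    rw [le_div_iff₀ hk']
    have h₁ := hval k
    unfold penalty at h₁
    have h₂ := sq_nonneg ‖(p k).fst - xbar‖
    linarith [hsndlow k]
  have hlim : Tendsto p atTop (𝓝 pbar) := by
    -- A cluster point (x, z) has x - x̄ ∈ K and z + ½‖x - x̄‖² ≤ r, while local minimality gives r
    -- ≤ f(x) ≤ z. The proximal term then forces x = x̄ and z = r.
    refine hDc.tendsto_nhds_of_unique_mapClusterPt (Eventually.of_forall hpmem) fun y hy hcl => ?_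
    obtain ⟨ψ, hψ, hψy⟩ := hcl.tendsto_subseq
    have l₁ := (hfst.tendsto y).comp hψy
    have l₂ := (hsnd.tendsto y).comp hψy
    have hyK : y.fst - xbar ∈ K := by
      rw [hK.mem_iff_infDist_zero ⟨0, h0⟩, ← sq_eq_zero_iff]
      refine tendsto_nhds_unique ?_ (hdist.comp hψ.tendsto_atTop)
      exact (((Metric.continuous_infDist_pt K).tendsto _).comp (l₁.sub_const xbar)).pow 2
    have hyval : y.snd + 1 / 2 * ‖y.fst - xbar‖ ^ 2 ≤ r := by
      refine le_of_tendsto (l₂.add (((l₁.sub_const xbar).norm.pow 2).const_mul (1 / 2)))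
        (Eventually.of_forall fun k => ?_)
      have h₁ := hval (ψ k)
      unfold penalty at h₁
      have h₂ : 0 ≤ ((ψ k : ℕ) : ℝ) / 2 * Metric.infDist ((p (ψ k)).fst - xbar) K ^ 2 := by
        positivity
      simp only [Function.comp_apply]
      linarith
    have hyball : y.fst ∈ Metric.ball xbar δ := by
      have h₁ := hy.2
      rw [Metric.mem_closedBall, dist_eq_norm] at h₁
      rw [Metric.mem_ball, dist_eq_norm]
      exact ((WithLp.norm_fst_le H (y - pbar)).trans h₁).trans_lt
        (hηlt.trans_le (min_le_right _ _))
    have hfy : (r : WithTop ℝ) ≤ (y.snd : WithTop ℝ) :=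
      hr ▸ (hball _ hyball hyK hy.1.2).trans hy.1.1
    have hry : r ≤ y.snd := WithTop.coe_le_coe.1 hfy
    have hsq : ‖y.fst - xbar‖ ^ 2 ≤ 0 := by linarith
    have hx : y.fst = xbar := by
      rw [← sub_eq_zero, ← norm_eq_zero]
      exact pow_eq_zero_iff two_ne_zero |>.1 (le_antisymm hsq (sq_nonneg _))
    have hz : y.snd = r := le_antisymm (by linarith [sq_nonneg ‖y.fst - xbar‖]) hry
    rw [hpbar, ← hx, ← hz]
    rfl
  have hdist_eq : ∀ k, Metric.infDist ((p k).fst - xbar) K = ‖(p k).fst - xbar - q k‖ := fun k => by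
    rw [hq k, dist_eq_norm]
  refine ⟨p, q, fun k => (hpmem k).1, hlim, fun k => ⟨hqK k, hdist_eq k⟩, ?_⟩
  -- Once p_k is inside the open ball, the truncation is inactive and the minimum is local on the
  -- whole set.
  filter_upwards [hlim.eventually (Metric.ball_mem_nhds pbar hη)] with k hk
  refine penalty_normal (Nat.cast_nonneg k) (hqK k) (hdist_eq k) ?_
  filter_upwards [self_mem_nhdsWithin,
    mem_nhdsWithin_of_mem_nhds (Metric.isOpen_ball.mem_nhds hk)] with u hu hub
  exact hpmin k ⟨hu, Metric.ball_subset_closedBall hub⟩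

end Penalization

/-! ### Penalty residuals as multipliers. -/

section Multipliers

variable {n ℓ₁ ℓ₂ : ℕ} {a₁ : Fin ℓ₁ → EuclideanSpace ℝ (Fin n)} {b : Fin ℓ₁ → ℝ}
  {a₂ : Fin ℓ₂ → EuclideanSpace ℝ (Fin n)} {c xbar : EuclideanSpace ℝ (Fin n)}

/-- T consists of the indices active at x̄ with ⟨a_i, q⟩ = 0. For these the residual pairs with a_i
exactly as x does, which is nonpositive because x ∈ C. -/
theorem sub_mem_polarMultipliers (hΘ : xbar ∈ Theta a₁ b) (hC : xbar ∈ coneC a₂)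
    {x q : EuclideanSpace ℝ (Fin n)} (hx : x ∈ coneC a₂) (hq : q ∈ faceCone a₁ b a₂ xbar)
    (hxq : Metric.infDist (x - xbar) (faceCone a₁ b a₂ xbar) = ‖x - xbar - q‖) :
    x - xbar - q ∈ polarMultipliers a₁ b a₂ xbar := by
  refine ⟨inner_sub_le_zero_of_infDist_eq (convex_faceCone a₁ b a₂ xbar)
    (fun x hx y hy => add_mem_faceCone a₁ b a₂ xbar hx hy) hq hxq,
    Set.mem_biUnion (active_mem_family₂ hΘ hC hq) ?_⟩
  rintro i ⟨hi, hiq⟩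
  rw [inner_sub_right, inner_sub_right, hiq, show inner ℝ (a₂ i) xbar = 0 from hi, sub_zero,
    sub_zero]
  exact hx i

/-- A local solution is the limit of points carrying normals to the epigraph of `f` with respect
to `C` whose horizontal parts are, up to sign and vanishing terms, in `polarMultipliers`. -/
theorem exists_normals_of_isLocalSolution {f : EuclideanSpace ℝ (Fin n) → WithTop ℝ} {r : ℝ}
    (hr : f xbar = (r : WithTop ℝ)) (hlsc : LocallyLscWrt (coneC a₂) f xbar r)
    (hsol : IsLocalSolution a₁ b a₂ c f xbar) :
    ∃ (y : ℕ → WithLp 2 (EuclideanSpace ℝ (Fin n) × ℝ)) (p d : ℕ → EuclideanSpace ℝ (Fin n)),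
      (∀ k, y k ∈ epigraph f ∩ cylinder ℝ (coneC a₂)) ∧
      Tendsto y atTop (𝓝 (WithLp.toLp 2 (xbar, r))) ∧
      (∀ k, p k ∈ polarMultipliers a₁ b a₂ xbar) ∧ Tendsto d atTop (𝓝 0) ∧
      ∀ k, WithLp.toLp 2 (-(p k + d k), (-1 : ℝ)) ∈
        frechetNormalConeWrt (cylinder ℝ (coneC a₂)) (y k) (epigraph f) := by
  obtain ⟨⟨hS, hC⟩, hmin⟩ := hsol
  have hmin' : ∀ᶠ x in 𝓝 xbar, x - xbar ∈ faceCone a₁ b a₂ xbar → x ∈ coneC a₂ →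
      f xbar ≤ f x := by
    filter_upwards [eventually_nhdsWithin_iff.1 hmin, eventually_mem_lowerSolutions (a₂ := a₂) hS]
      with x hx hxS hxK hxC using hx ⟨hxS hxK, hxC⟩
  obtain ⟨y, q, hy, hylim, hq, hnormal⟩ := exists_penalization hr hC hlsc
    (isClosed_faceCone a₁ b a₂ xbar) (zero_mem_faceCone a₁ b a₂ xbar) hmin'
  have hfst : Tendsto (fun k => (y k).fst) atTop (𝓝 xbar) :=
    ((continuous_fst.comp (WithLp.prod_continuous_ofLp 2 _ ℝ)).tendsto _).comp hylim
  obtain ⟨N, hN⟩ := eventually_atTop.1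
    (hnormal.and (hfst.eventually (eventually_mem_radialCone (a₁ := a₁) (b := b) hC)))
  refine ⟨fun k => y (k + N), fun k => ((k + N : ℕ) : ℝ) • ((y (k + N)).fst - xbar - q (k + N)),
    fun k => (y (k + N)).fst - xbar, fun k => hy _, hylim.comp (tendsto_add_atTop_nat N),
    fun k => ?_, ?_, fun k => ⟨?_, (hN _ (Nat.le_add_left N k)).1⟩⟩
  · exact smul_mem_polarMultipliers a₁ b a₂ xbar (Nat.cast_nonneg _)
      (sub_mem_polarMultipliers hS.1 hC (hy _).2 (hq _).1 (hq _).2)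
  · simpa using (hfst.comp (tendsto_add_atTop_nat N)).sub_const xbar
  · obtain ⟨s, hs, h⟩ := (hN _ (Nat.le_add_left N k)).2 (hy _).2 (q (k + N)) (hq _).1
      ((k + N : ℕ) : ℝ) (Nat.cast_nonneg _)
    exact ⟨s, hs, h⟩

end Multipliers

end SimpleBilevel

/-! ### Passage to the limit: bounded or unbounded multipliers. -/

theorem mainTheorem8 {n ℓ₁ ℓ₂ : ℕ}
    (a₁ : Fin ℓ₁ → EuclideanSpace ℝ (Fin n)) (b : Fin ℓ₁ → ℝ)
    (a₂ : Fin ℓ₂ → EuclideanSpace ℝ (Fin n)) (c : EuclideanSpace ℝ (Fin n))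
    (f : EuclideanSpace ℝ (Fin n) → WithTop ℝ)
    (xbar : EuclideanSpace ℝ (Fin n)) (r : ℝ) (hr : f xbar = (r : WithTop ℝ))
    (hlsc : SimpleBilevel.LocallyLscWrt (SimpleBilevel.coneC a₂) f xbar r)
    (hsol : SimpleBilevel.IsRobustLocalSolution a₁ b a₂ c f xbar)
    (hi : (-SimpleBilevel.horizonSubdiffWrt (SimpleBilevel.coneC a₂) f xbar) ∩
      SimpleBilevel.multiplierSet a₁ b a₂ xbar = {0})
    (hii : SimpleBilevel.NormalDensed
      (SimpleBilevel.Omega₁ f) (SimpleBilevel.Omega₂ a₁ b c)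
      (SimpleBilevel.cylinder (WithLp 2 (EuclideanSpace ℝ (Fin n) × ℝ)) (SimpleBilevel.coneC a₂))
      (SimpleBilevel.cylinder (WithLp 2 (EuclideanSpace ℝ (Fin n) × ℝ)) (SimpleBilevel.coneC a₂))
      (WithLp.toLp 2 (xbar, WithLp.toLp 2 ((0 : EuclideanSpace ℝ (Fin n)), r)))) :
    0 ∈ SimpleBilevel.limitingSubdiffWrt (SimpleBilevel.coneC a₂) f xbar +
      SimpleBilevel.multiplierSet a₁ b a₂ xbar := by
  obtain ⟨y, p, d, hy, hylim, hp, hd, hnormal⟩ :=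
    SimpleBilevel.exists_normals_of_isLocalSolution hr hlsc hsol.1
  have hC := hsol.2.1.2
  have hcont := WithLp.prod_continuous_toLp 2 (EuclideanSpace ℝ (Fin n)) ℝ
  have hclosed := SimpleBilevel.isClosed_polarMultipliers a₁ b a₂ xbar
  by_cases hb : ∃ R : ℝ, ∃ᶠ k in atTop, p k ∈ Metric.closedBall 0 R
  · obtain ⟨R, hR⟩ := hb
    obtain ⟨v, -, φ, hφ, hv⟩ :=
      tendsto_subseq_of_frequently_bounded Metric.isBounded_closedBall hR
    refine Set.mem_add.2 ⟨-v, ⟨hC, r, hr, y ∘ φ, _, fun k => hy _, hylim.comp hφ.tendsto_atTop,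
      fun k => hnormal (φ k), ?_⟩, v,
      SimpleBilevel.polarMultipliers_subset_multiplierSet a₁ b a₂ xbar
        (hclosed.mem_of_tendsto hv (Eventually.of_forall fun k => hp _)), neg_add_cancel v⟩
    have hlim := (hv.add (hd.comp hφ.tendsto_atTop)).neg
    rw [add_zero] at hlim
    exact (hcont.tendsto _).comp (hlim.prodMk_nhds tendsto_const_nhds)
  · exfalso
    have hnorm : Tendsto (fun k => ‖p k‖) atTop atTop := by
      refine tendsto_atTop.2 fun R => ?_
      have hR : ¬ ∃ᶠ k in atTop, p k ∈ Metric.closedBall 0 R := fun h => hb ⟨R, h⟩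
      filter_upwards [not_frequently.1 hR] with k hk
      rw [mem_closedBall_zero_iff, not_le] at hk
      exact hk.le
    obtain ⟨N, hN⟩ := eventually_atTop.1 (hnorm.eventually_gt_atTop 0)
    have hpos : ∀ k, 0 < ‖p (k + N)‖ := fun k => hN _ (Nat.le_add_left N k)
    have hshift := tendsto_add_atTop_nat N
    obtain ⟨v, hv, φ, hφ, hvlim⟩ :=
      (isCompact_sphere (0 : EuclideanSpace ℝ (Fin n)) 1).tendsto_subseq
        (x := fun k => ‖p (k + N)‖⁻¹ • p (k + N)) (fun k => by
          rw [mem_sphere_zero_iff_norm, norm_smul, norm_inv, norm_norm,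
            inv_mul_cancel₀ (hpos k).ne'])
    have hφN : Tendsto (fun k => φ k + N) atTop atTop := hshift.comp hφ.tendsto_atTop
    have hinv : Tendsto (fun k => ‖p (φ k + N)‖⁻¹) atTop (𝓝 0) :=
      tendsto_inv_atTop_zero.comp (hnorm.comp hφN)
    have hvM : v ∈ SimpleBilevel.multiplierSet a₁ b a₂ xbar :=
      SimpleBilevel.polarMultipliers_subset_multiplierSet a₁ b a₂ xbar
        (hclosed.mem_of_tendsto hvlim (Eventually.of_forall fun k =>
          SimpleBilevel.smul_mem_polarMultipliers a₁ b a₂ xbar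
            (inv_nonneg.2 (norm_nonneg _)) (hp _)))
    have hvh : v ∈ -SimpleBilevel.horizonSubdiffWrt (SimpleBilevel.coneC a₂) f xbar := by
      refine ⟨hC, r, hr, fun k => y (φ k + N), _, fun k => hy _, hylim.comp hφN,
        fun k => SimpleBilevel.smul_mem_frechetNormalConeWrt (inv_pos.2 (hpos (φ k)))
          (hnormal (φ k + N)), ?_⟩
      have h₁ : Tendsto (fun k => ‖p (φ k + N)‖⁻¹ • -(p (φ k + N) + d (φ k + N))) atTop
          (𝓝 (-v)) := by
        have := (hvlim.add (hinv.smul (hd.comp hφN))).neg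
        rw [zero_smul, add_zero] at this
        refine this.congr fun k => ?_
        simp only [Function.comp_apply, smul_neg, smul_add]
      -- After normalization the last component -1 fades to 0, so the limit is a horizon
      -- subgradient.
      have h₂ : Tendsto (fun k => ‖p (φ k + N)‖⁻¹ • (-1 : ℝ)) atTop (𝓝 0) := by
        simpa using hinv.neg
      exact (hcont.tendsto _).comp (h₁.prodMk_nhds h₂)
    have hv0 : v = 0 := by
      have : v ∈ ({0} : Set (EuclideanSpace ℝ (Fin n))) := hi ▸ ⟨hvh, hvM⟩
      exact this
    rw [hv0, mem_sphere_zero_iff_norm, norm_zero] at hv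
    exact zero_ne_one hv
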